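/- Let $\Phi$ be an irreducible reduced (crystallographic) root system in a finite-dimensional real vector space $V$, with Weyl group $W$. Let $(\,\cdot\,|\,\cdot\,)$ be the $W$-invariant scalar product on $V$ such that $\min_{\alpha\in\Phi}(\alpha|\alpha)=1$, and let $r=\max_{\alpha\in\Phi}(\alpha|\alpha)$. A root $\alpha$ is long if $(\alpha|\alpha)=r$ and short otherwise; $\Phi_{\mathrm{lg}}$ is the set of long roots. Fix a basis $\Delta$ of $\Phi$, with set of positive roots $\Phi^+$, let $\Delta_{\mathrm{lg}}=\Delta\cap\Phi_{\mathrm{lg}}$, let $l$ be the length function of $W$ with respect to the reflections $s_\alpha$, $\alpha\in\Delta$, and let $\tilde\alpha$ be the highest root. For a root $\alpha$ let $\mathrm{ht}^\vee(\alpha)$ be the height of the coroot $\alpha^\vee$ with respect to $\{\delta^\vee : \delta\in\Delta\}$. The level of $\alpha\in\Phi_{\mathrm{lg}}$ is $$L(\alpha)=\mathrm{ht}^\vee(\tilde\alpha)-\mathrm{ht}^\vee(\alpha)\ \text{ if }\alpha\in\Phi^+,\qquad L(\alpha)=\mathrm{ht}^\vee(\tilde\alpha)-\mathrm{ht}^\vee(\alpha)-1\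 \text{ if }\alpha\in-\Phi^+ .$$ For $\alpha,\beta\in\Phi_{\mathrm{lg}}$ and $\gamma\in\Phi^+$ write $\beta\xrightarrow{\gamma}\alpha$ if $\alpha=s_\gamma(\beta)$ and $L(\alpha)=L(\beta)+1$, and write $\alpha\preceq\beta$ if there is a finite (possibly empty) sequence of such arrows leading from $\beta$ to $\alpha$ through long roots. For $w,w'\in W$ and $\gamma\in\Phi^+$ write $w\xrightarrow{\gamma}w'$ if $w'=s_\gamma w$ and $l(w')=l(w)+1$; the Bruhat order $\leqslant$ on $W$ is the reflexive and transitive closure of these arrows. Let $\tilde I=\{\alpha\in\Delta : (\tilde\alpha|\alpha)=0\}$, let $\Phi_{\tilde I}^+$ be the set of positive roots in the linear span of $\tilde I$, and let $X_{\tilde I}=\{w\in W : w(\Phi_{\tilde I}^+)\subset\Phi^+\}$ be the set of minimal length representatives of the cosets of $W_{\tilde I}=\langle s_\alpha : \alpha\in\tilde I\rangle$ in $W/W_{\tilde I}$, with the restriction of the Bruhat order. Theorem. The map $X_{\tilde I}\to\Phi_{\mathrm{lg}}$, $x\mapsto x(\tilde\alpha)$, is a bijection, and it is an anti-isomorphism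 between the posets $(X_{\tilde I},\leqslant)$ and $(\Phi_{\mathrm{lg}},\preceq)$. Denote by $x_\alpha$ the element of $X_{\tilde I}$ with $x_\alpha(\tilde\alpha)=\alpha$. Then $l(x_\alpha)=L(\alpha)$ for every $\alpha\in\Phi_{\mathrm{lg}}$, and for all $\alpha,\beta\in\Phi_{\mathrm{lg}}$ and $\gamma\in\Phi^+$, $$\beta\xrightarrow{\gamma}\alpha\quad\Longleftrightarrow\quad x_\beta\xrightarrow{\gamma}x_\alpha .$$ Moreover, if $\beta\xrightarrow{\gamma}\alpha$, then the integer $\partial_{\alpha\beta}=\langle\beta,\gamma^\vee\rangle$ is determined as follows: (i) if $\beta\in\Delta_{\mathrm{lg}}$ and $\alpha\in-\Delta_{\mathrm{lg}}$, then either $\alpha=-\beta$, and $\partial_{\alpha\beta}=2$, or $\beta+(-\alpha)$ is a root, and $\partial_{\alpha\beta}=1$; (ii) otherwise, $\partial_{\alpha\beta}$ is equal to $1$ if $\gamma$ is long, and to $r$ if $\gamma$ is short. -/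

import Mathlib

/-!
Long roots of a finite irreducible reduced root system, ordered by paths, and distinguished coset
representatives of the Weyl group, ordered by the Bruhat order.

Roots are designated by their indices `i : ι`; the root itself is `P.root i`.
-/

namespace LongRoots

variable {ι V N : Type*} [AddCommGroup V] [Module ℝ V] [AddCommGroup N] [Module ℝ N]
  {P : RootPairing ι ℝ V N}

/-- If `r` raises a grading `f : X → ℤ` by one, then its reflexive transitive closure cannot lower
`f`, and relates only equal elements of the same degree. -/
theorem le_and_eq_of_reflTransGen {X : Type*} {r : X → X → Prop} {f : X → ℤ}
    (h : ∀ a b, r a b → f b = f a + 1) {a b : X} (hab : Relation.ReflTransGen r a b) :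
    f a ≤ f b ∧ (f b ≤ f a → a = b) := by
  induction hab with
  | refl => exact ⟨le_rfl, fun _ => rfl⟩
  | tail _ hcd ih =>
    have hd := h _ _ hcd
    exact ⟨by linarith [ih.1], fun hle => by linarith [ih.1]⟩

section Roots

/-- The squared length `(α|α)` of a root. -/
noncomputable def sqLength (B : P.InvariantForm) (i : ι) : ℝ :=
  B.form (P.root i) (P.root i)

/-- The number `r = max (α|α)`, over all roots `α`. -/
noncomputable def maxSqLength (B : P.InvariantForm) : ℝ :=
  ⨆ i, sqLength B i

/-- A root is long if `(α|α) = r`. The other roots are short. -/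
def IsLong (B : P.InvariantForm) (i : ι) : Prop :=
  sqLength B i = maxSqLength B

/-- `a` is the highest root: `P.root a - β` is a sum of simple roots, for every root `β`. -/
def IsHighestRoot (b : P.Base) (a : ι) : Prop :=
  ∀ i, P.root a - P.root i ∈ AddSubmonoid.closure (P.root '' b.support)

/-- The dual height of a root: the height of the corresponding coroot. -/
noncomputable def dualHeight (b : P.Base) (i : ι) : ℤ :=
  b.flip.height i

open Classical in
/-- The level of a root, where `a` is the highest root. -/
noncomputable def level (b : P.Base) (a i : ι) : ℤ :=
  if b.IsPos i then dualHeight b a - dualHeight b i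
  else dualHeight b a - dualHeight b i - 1

/-- The set of long roots. The highest root `a` and the base enter only in the order below. -/
def LongRoot (_b : P.Base) (B : P.InvariantForm) (_a : ι) : Type _ :=
  {i : ι // IsLong B i}

variable {b : P.Base} {B : P.InvariantForm} {a : ι}

/-- The index of a long root. -/
def LongRoot.idx (α : LongRoot b B a) : ι := α.val

/-- `β ⟶[γ] α`: `γ` is a positive root, `α = s_γ β`, and the level of `α` is that of `β` plus
one. -/
def LongRoot.Step (γ : ι) (β α : LongRoot b B a) : Prop :=
  b.IsPos γ ∧ α.idx = P.reflectionPerm γ β.idx ∧ level b a α.idx = level b a β.idx + 1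

/-- There is a path from `β` to `α`. -/
def LongRoot.Path (β α : LongRoot b B a) : Prop :=
  Relation.ReflTransGen (fun β α : LongRoot b B a => ∃ γ, LongRoot.Step γ β α) β α

/-- The path order: `α ≼ β` if there is a path from `β` to `α`. -/
instance : PartialOrder (LongRoot b B a) where
  le α β := LongRoot.Path β α
  le_refl _ := Relation.ReflTransGen.refl
  le_trans _ _ _ h₁ h₂ := Relation.ReflTransGen.trans h₂ h₁
  le_antisymm α β h₁ h₂ := by
    have hs : ∀ x y : LongRoot b B a, (∃ γ, LongRoot.Step γ x y) →
        level b a y.idx = level b a x.idx + 1 := fun _ _ ⟨_, h⟩ => h.2.2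
    exact ((le_and_eq_of_reflTransGen (f := fun x : LongRoot b B a => level b a x.idx) hs h₁).2
      (le_and_eq_of_reflTransGen (f := fun x : LongRoot b B a => level b a x.idx) hs h₂).1).symm

end Roots

section Weyl

/-- The length of an element of the Weyl group with respect to the simple reflections: the least
length of a word in the simple reflections which represents it. -/
noncomputable def length (b : P.Base) (w : P.weylGroup) : ℕ :=
  sInf {n | ∃ l : List ι, (∀ i ∈ l, i ∈ b.support) ∧ l.length = n ∧
    (l.map (RootPairing.weylGroup.ofIdx P)).prod = w}

/-- `w ⟶[γ] w'`: `γ` is a positive root, `w' = s_γ w` and `l(w') = l(w) + 1`. -/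
def WeylStep (b : P.Base) (γ : ι) (w w' : P.weylGroup) : Prop :=
  b.IsPos γ ∧ w' = RootPairing.weylGroup.ofIdx P γ * w ∧ length b w' = length b w + 1

/-- The Bruhat order on the Weyl group. -/
def BruhatLE (b : P.Base) (w w' : P.weylGroup) : Prop :=
  Relation.ReflTransGen (fun w w' => ∃ γ, WeylStep b γ w w') w w'

/-- `w` lies in `X_I`: it maps every positive root in the linear span of `I` to a positive
root. -/
def IsMinRep (b : P.Base) (I : Set ι) (w : P.weylGroup) : Prop :=
  ∀ i, P.root i ∈ Submodule.span ℝ (P.root '' I) → b.IsPos i → b.IsPos (P.weylGroupToPerm w i)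

/-- The set `X_I` of distinguished representatives of the cosets in `W / W_I`. -/
def MinRep (b : P.Base) (I : Set ι) : Type _ :=
  {w : P.weylGroup // IsMinRep b I w}

/-- The underlying element of the Weyl group. -/
def MinRep.toWeyl {b : P.Base} {I : Set ι} (x : MinRep b I) : P.weylGroup := x.val

/-- The restriction of the Bruhat order to `X_I`. -/
instance {b : P.Base} {I : Set ι} : PartialOrder (MinRep b I) where
  le x y := BruhatLE b x.toWeyl y.toWeyl
  le_refl _ := Relation.ReflTransGen.refl
  le_trans _ _ _ h₁ h₂ := Relation.ReflTransGen.trans h₁ h₂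
  le_antisymm x y h₁ h₂ := by
    have hs : ∀ v w : P.weylGroup, (∃ γ, WeylStep b γ v w) →
        (length b w : ℤ) = length b v + 1 := fun _ _ ⟨_, h⟩ => by exact_mod_cast h.2.2
    exact Subtype.ext
      ((le_and_eq_of_reflTransGen (f := fun w : P.weylGroup => (length b w : ℤ)) hs h₁).2
        (le_and_eq_of_reflTransGen (f := fun w : P.weylGroup => (length b w : ℤ)) hs h₂).1)

/-- The set of the simple roots which are orthogonal to the root `a`. -/
def orthSimple (b : P.Base) (B : P.InvariantForm) (a : ι) : Set ι :=
  {i | i ∈ b.support ∧ B.form (P.root a) (P.root i) = 0}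

end Weyl

end LongRoots

/-! Write `a` for the highest root and X for the set of minimal representatives.

Bijectivity. Since `a` is dominant, the positive roots in the span of the simple roots orthogonal to
`a` are exactly the positive roots orthogonal to `a`. If x, y in X agree on `a`, then x⁻¹y fixes
`a`, so it can only make positive roots orthogonal to `a` negative, and membership in X forbids
that; hence x⁻¹y = 1. Conversely, a long root other than `a` is not dominant, so some simple
reflection lowers its level, by exactly one; descending to `a` writes the root as x(a) with x of
length at most its level. No w has length below the level of w(a), so length and level agree on X.

Order. If x in X lies over β, a step from β through γ lifts to s_γ x, which is again in X
(`Step.isPos_reflectionPerm`); thus paths lift to Bruhat chains. A Bruhat chain between members of X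
may leave X. Its image under w ↦ w(a) moves by reflections at acute angles, which may raise the
level by more than one, and `path_reflect` replaces each such move by a path. Its proof rests on a
lifting property of simple reflections, as for the Bruhat order.

Coefficients. A step with γ ≠ β has ⟨γ,β^∨⟩ = 1 because β is long, and the symmetry of the form
turns this into ⟨β,γ^∨⟩(γ|γ) = r. Comparing heights and dual heights shows that γ is simple unless
the step goes from a simple root to the opposite of one. -/

namespace LongRoots

open RootPairing

variable {ι V N : Type*} [AddCommGroup V] [Module ℝ V] [AddCommGroup N] [Module ℝ N]
  {P : RootPairing ι ℝ V N} {b : P.Base}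

/-! ### Heights, dual heights and the level under reflections -/

section Heights

lemma dualHeight_ne_zero (b : P.Base) (i : ι) : dualHeight b i ≠ 0 :=
  b.flip.height_ne_zero i

lemma dualHeight_of_mem_support {i : ι} (hi : i ∈ b.support) : dualHeight b i = 1 :=
  RootPairing.Base.height_one_of_mem_support (b := b.flip) hi

lemma isPos_reflectionPerm_self {i : ι} : b.IsPos (P.reflectionPerm i i) ↔ ¬ b.IsPos i :=
  RootPairing.Base.IsPos.neg_iff_not b i

lemma reflectionPerm_reflectionPerm_reflectionPerm (δ γ i : ι) :
    P.reflectionPerm (P.reflectionPerm δ γ) (P.reflectionPerm δ i) =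
      P.reflectionPerm δ (P.reflectionPerm γ i) := by
  apply P.root.injective
  simp only [root_reflectionPerm, reflection_reflectionPerm]
  simp

lemma isReduced_flip [Finite ι] [P.IsReduced] : P.flip.IsReduced := by
  have : Module.IsReflexive ℝ N := .of_isPerfPair P.flip.toLinearMap
  infer_instance

variable [P.IsCrystallographic]

lemma root_reflectionPerm_eq_add_zsmul (γ i : ι) :
    P.root (P.reflectionPerm γ i) = P.root i + (-P.pairingIn ℤ i γ) • P.root γ := by
  rw [root_reflectionPerm, neg_smul, reflection_apply_root' ℤ, sub_eq_add_neg]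

lemma pairingIn_flip (i j : ι) : P.flip.pairingIn ℤ i j = P.pairingIn ℤ j i := by
  have h : algebraMap ℤ ℝ (P.flip.pairingIn ℤ i j) = algebraMap ℤ ℝ (P.pairingIn ℤ j i) := by
    rw [algebraMap_pairingIn, algebraMap_pairingIn, pairing_flip]
  simpa using h

lemma coroot_reflectionPerm_eq_add_zsmul (γ i : ι) :
    P.coroot (P.reflectionPerm γ i) = P.coroot i + (-P.pairingIn ℤ γ i) • P.coroot γ := by
  have := root_reflectionPerm_eq_add_zsmul (P := P.flip) γ i
  rwa [pairingIn_flip] at this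

lemma height_reflectionPerm (b : P.Base) (γ i : ι) :
    b.height (P.reflectionPerm γ i) = b.height i - P.pairingIn ℤ i γ * b.height γ := by
  rw [b.height_add_zsmul (root_reflectionPerm_eq_add_zsmul γ i), smul_eq_mul]
  ring

lemma dualHeight_reflectionPerm (b : P.Base) (γ i : ι) :
    dualHeight b (P.reflectionPerm γ i) =
      dualHeight b i - P.pairingIn ℤ γ i * dualHeight b γ := by
  have := height_reflectionPerm b.flip γ i
  rwa [pairingIn_flip] at this

lemma pairingIn_reflectionPerm_left (γ i j : ι) :
    P.pairingIn ℤ (P.reflectionPerm γ i) j =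
      P.pairingIn ℤ i j - P.pairingIn ℤ i γ * P.pairingIn ℤ γ j := by
  have h : algebraMap ℤ ℝ (P.pairingIn ℤ (P.reflectionPerm γ i) j) =
      algebraMap ℤ ℝ (P.pairingIn ℤ i j - P.pairingIn ℤ i γ * P.pairingIn ℤ γ j) := by
    rw [map_sub, map_mul]
    simp only [algebraMap_pairingIn]
    rw [← root_coroot_eq_pairing, root_reflectionPerm, reflection_apply_root]
    simp
  exact FaithfulSMul.algebraMap_injective ℤ ℝ h

lemma pairingIn_reflectionPerm_reflectionPerm (γ i j : ι) :
    P.pairingIn ℤ (P.reflectionPerm γ i) (P.reflectionPerm γ j) = P.pairingIn ℤ i j := by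
  rw [pairingIn_reflectionPerm, reflectionPerm_self]

lemma reflectionPerm_eq_of_pairingIn_eq_zero {γ i : ι} (h : P.pairingIn ℤ i γ = 0) :
    P.reflectionPerm γ i = i := by
  apply P.root.injective
  rw [root_reflectionPerm_eq_add_zsmul, h]
  simp

variable [Finite ι] [P.IsReduced]

/-- A positive root makes an acute angle with some simple root. If it is not simple, that reflection
keeps it positive while lowering its height, which is impossible from height one. -/
lemma mem_support_of_height_eq_one {i : ι} (h : b.height i = 1) : i ∈ b.support := by
  have hi : b.IsPos i := by rw [RootPairing.Base.isPos_iff, h]; exact one_pos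
  obtain ⟨j, hj, hp⟩ := hi.exists_mem_support_pos_pairingIn
  by_contra hne
  have hij : i ≠ j := fun e => hne (e ▸ hj)
  have hpos := hi.reflectionPerm hj hij
  rw [RootPairing.Base.isPos_iff, height_reflectionPerm, h,
    RootPairing.Base.height_one_of_mem_support hj] at hpos
  have := (P.zero_lt_pairingIn_iff' ℤ).1 hp
  linarith

lemma mem_support_of_dualHeight_eq_one {i : ι} (h : dualHeight b i = 1) : i ∈ b.support := by
  have := isReduced_flip (P := P)
  exact mem_support_of_height_eq_one (b := b.flip) h

/-- Positivity of roots and positivity of coroots behave alike under negation and under a simple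
reflection, which permutes the positive ones other than its own. These operations reach every root
from the simple ones. -/
lemma isPos_iff_dualHeight_pos {i : ι} : b.IsPos i ↔ 0 < dualHeight b i := by
  have := isReduced_flip (P := P)
  change b.IsPos i ↔ b.flip.IsPos i
  have hneg : ∀ k, b.flip.IsPos (P.reflectionPerm k k) ↔ ¬ b.flip.IsPos k := fun k =>
    isPos_reflectionPerm_self (P := P.flip) (b := b.flip)
  refine b.induction_reflect (p := fun i => b.IsPos i ↔ b.flip.IsPos i) i ?_ ?_ ?_
  · intro k hk
    rw [isPos_reflectionPerm_self, hneg, hk]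
  · intro k hk
    exact iff_of_true (RootPairing.Base.isPos_of_mem_support hk)
      (RootPairing.Base.isPos_of_mem_support (b := b.flip) hk)
  · intro k j hk hj
    have hpj : b.IsPos j := RootPairing.Base.isPos_of_mem_support hj
    have hpj' : b.flip.IsPos j := RootPairing.Base.isPos_of_mem_support (b := b.flip) hj
    by_cases h1 : k = j
    · subst h1
      rw [isPos_reflectionPerm_self, hneg, hk]
    by_cases hp : b.IsPos k
    · exact iff_of_true (hp.reflectionPerm hj h1)
        ((hk.1 hp).reflectionPerm (P := P.flip) (b := b.flip) hj h1)
    -- For `k` negative the argument is applied to `-k`; the exception `-k = j` is a mere negation.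
    · by_cases h2 : P.reflectionPerm k k = j
      · have e : P.reflectionPerm j k = P.reflectionPerm k k := by
          apply P.root.injective
          subst h2
          simp [reflection_reflectionPerm]
        rw [e, isPos_reflectionPerm_self, hneg, hk]
      · have e : P.reflectionPerm j (P.reflectionPerm k k) =
            P.reflectionPerm (P.reflectionPerm j k) (P.reflectionPerm j k) := by
          apply P.root.injective
          rw [root_reflectionPerm, root_reflectionPerm, root_reflectionPerm,
            reflection_apply_self, reflection_apply_self, root_reflectionPerm, map_neg]
        have a1 := (isPos_reflectionPerm_self.2 hp).reflectionPerm hj h2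
        have a2 := ((hneg k).2 (fun h => hp (hk.2 h))).reflectionPerm
          (P := P.flip) (b := b.flip) hj h2
        rw [e, isPos_reflectionPerm_self] at a1
        change b.flip.IsPos (P.reflectionPerm j (P.reflectionPerm k k)) at a2
        rw [e, hneg] at a2
        exact iff_of_false a1 a2

/-- The dual height drops by at least one. If it changes sign it drops by at least two, since no
root has dual height zero, and this pays for the `-1` in the level of a negative root. -/
lemma level_lt_level_reflectionPerm (a : ι) {γ i : ι} (hγ : b.IsPos γ)
    (h : 0 < P.pairingIn ℤ i γ) : level b a i < level b a (P.reflectionPerm γ i) := by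
  have h' := (P.zero_lt_pairingIn_iff' ℤ).1 h
  have hg := isPos_iff_dualHeight_pos.1 hγ
  have hm : 0 < P.pairingIn ℤ γ i * dualHeight b γ := mul_pos h' hg
  have h0 := dualHeight_ne_zero b i
  have h1 := dualHeight_ne_zero b (P.reflectionPerm γ i)
  have h2 := dualHeight_reflectionPerm b γ i
  simp only [level, isPos_iff_dualHeight_pos]
  split_ifs <;> omega

lemma level_reflectionPerm_lt_level (a : ι) {γ i : ι} (hγ : b.IsPos γ)
    (h : P.pairingIn ℤ i γ < 0) : level b a (P.reflectionPerm γ i) < level b a i := by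
  have := level_lt_level_reflectionPerm a (i := P.reflectionPerm γ i) hγ (by
    rw [pairingIn_reflectionPerm_left, pairingIn_same]; linarith)
  rwa [reflectionPerm_self] at this

end Heights

/-! ### Root lengths and pairings with long roots -/

section Long

variable {B : P.InvariantForm}

lemma sqLength_pos (hpos : ∀ v : V, v ≠ 0 → 0 < B.form v v) (i : ι) : 0 < sqLength B i :=
  hpos _ (P.ne_zero i)

lemma sqLength_reflectionPerm (γ i : ι) : sqLength B (P.reflectionPerm γ i) = sqLength B i := by
  simp [sqLength]

lemma isLong_reflectionPerm {γ i : ι} : IsLong B (P.reflectionPerm γ i) ↔ IsLong B i := by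
  rw [IsLong, sqLength_reflectionPerm, IsLong]

lemma sqLength_le_maxSqLength [Finite ι] (i : ι) : sqLength B i ≤ maxSqLength B :=
  le_ciSup (Set.finite_range _).bddAbove i

lemma exists_isLong [Finite ι] [Nonempty ι] : ∃ i, IsLong B i :=
  exists_eq_ciSup_of_finite

variable [P.IsCrystallographic]

lemma pairingIn_mul_sqLength (i j : ι) :
    (P.pairingIn ℤ j i : ℝ) * sqLength B i = P.pairingIn ℤ i j * sqLength B j := by
  have := B.pairing_mul_eq_pairing_mul_swap i j
  rwa [← P.algebraMap_pairingIn ℤ, ← P.algebraMap_pairingIn ℤ] at this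

lemma two_mul_form_root_root (i j : ι) :
    2 * B.form (P.root i) (P.root j) = P.pairingIn ℤ i j * sqLength B j := by
  have := B.two_mul_apply_root_root i j
  rwa [← P.algebraMap_pairingIn ℤ] at this

lemma form_root_root_nonneg_iff (hpos : ∀ v : V, v ≠ 0 → 0 < B.form v v) (i j : ι) :
    0 ≤ B.form (P.root i) (P.root j) ↔ 0 ≤ P.pairingIn ℤ i j := by
  have h1 := two_mul_form_root_root (B := B) i j
  have h2 := sqLength_pos hpos j
  constructor
  · intro h
    have : (0 : ℝ) ≤ P.pairingIn ℤ i j := by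
      by_contra hc
      have := mul_neg_of_neg_of_pos (not_le.1 hc) h2
      linarith
    exact_mod_cast this
  · intro h
    have : (0 : ℝ) ≤ P.pairingIn ℤ i j := by exact_mod_cast h
    have := mul_nonneg this h2.le
    linarith

variable [Finite ι] [P.IsReduced]

/-- Of the two positive pairings, the one against the coroot of the long root is the smaller. For
non-proportional roots their product is at most three, so the smaller one is 1. -/
lemma pairingIn_eq_one_of_isLong (hpos : ∀ v : V, v ≠ 0 → 0 < B.form v v) {i j : ι}
    (hi : IsLong B i) (hne : j ≠ i) (h : 0 < P.pairingIn ℤ i j) : P.pairingIn ℤ j i = 1 := by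
  have h' := (P.zero_lt_pairingIn_iff' ℤ).1 h
  have hmul := pairingIn_mul_sqLength (B := B) i j
  have hle : (P.pairingIn ℤ j i : ℝ) ≤ P.pairingIn ℤ i j := by
    have h1 : sqLength B j ≤ sqLength B i := (sqLength_le_maxSqLength j).trans hi.ge
    have h2 : (0 : ℝ) < P.pairingIn ℤ i j := by exact_mod_cast h
    have h3 := mul_le_mul_of_nonneg_left h1 h2.le
    rw [← hmul] at h3
    exact le_of_mul_le_mul_right h3 (sqLength_pos hpos i)
  have hle' : P.pairingIn ℤ j i ≤ P.pairingIn ℤ i j := by exact_mod_cast hle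
  have hmem := P.pairingIn_pairingIn_mem_set_of_isCrystal_of_isRed' i j
    (fun e => hne (P.root.injective e).symm) (fun e => by
      have e' := P.root_eq_neg_iff.1 e
      rw [e', pairingIn_reflectionPerm_self_left, pairingIn_same] at h
      omega)
  simp only [Set.mem_insert_iff, Set.mem_singleton_iff, Prod.mk.injEq] at hmem
  omega

/-- The dual height drops by exactly one, except when `δ = i`: then it passes from 1 to -1, and the
level still rises by one. -/
lemma level_reflectionPerm_of_mem_support (hpos : ∀ v : V, v ≠ 0 → 0 < B.form v v) (a : ι)
    {δ i : ι} (hδ : δ ∈ b.support) (hi : IsLong B i) (h : 0 < P.pairingIn ℤ i δ) :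
    level b a (P.reflectionPerm δ i) = level b a i + 1 := by
  have h0 := dualHeight_ne_zero b i
  have h1 := dualHeight_ne_zero b (P.reflectionPerm δ i)
  have h2 := dualHeight_reflectionPerm b δ i
  have h3 := dualHeight_of_mem_support hδ
  have h4 : P.pairingIn ℤ δ i = 1 ∨ (P.pairingIn ℤ δ i = 2 ∧ dualHeight b i = 1) := by
    by_cases e : δ = i
    · subst e; exact .inr ⟨by simp, h3⟩
    · exact .inl (pairingIn_eq_one_of_isLong hpos hi e h)
  rw [h3] at h2
  simp only [level, isPos_iff_dualHeight_pos]
  split_ifs <;> omega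

end Long

end LongRoots

namespace LongRoots

open RootPairing Relation

variable {ι V N : Type*} [AddCommGroup V] [Module ℝ V] [AddCommGroup N] [Module ℝ N]
  {P : RootPairing ι ℝ V N} {b : P.Base} {B : P.InvariantForm} {a : ι}

/-! ### Steps and paths between long roots -/

namespace LongRoot

lemma idx_injective : Function.Injective (idx : LongRoot b B a → ι) := Subtype.val_injective

lemma isLong (α : LongRoot b B a) : IsLong B α.idx := α.2

/-- The image of a long root under a reflection. -/
def reflect (γ : ι) (α : LongRoot b B a) : LongRoot b B a :=
  ⟨P.reflectionPerm γ α.idx, isLong_reflectionPerm.2 α.2⟩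

@[simp] lemma idx_reflect (γ : ι) (α : LongRoot b B a) :
    (reflect γ α).idx = P.reflectionPerm γ α.idx := rfl

@[simp] lemma reflect_reflect (γ : ι) (α : LongRoot b B a) : reflect γ (reflect γ α) = α :=
  idx_injective (by simp)

lemma reflect_reflectionPerm (δ γ : ι) (α : LongRoot b B a) :
    reflect (P.reflectionPerm δ γ) (reflect δ α) = reflect δ (reflect γ α) :=
  idx_injective (reflectionPerm_reflectionPerm_reflectionPerm δ γ α.idx)

lemma Step.eq_reflect {γ : ι} {β α : LongRoot b B a} (h : Step γ β α) : α = reflect γ β :=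
  idx_injective h.2.1

lemma Step.path {γ : ι} {β α : LongRoot b B a} (h : Step γ β α) : Path β α :=
  ReflTransGen.single ⟨γ, h⟩

variable [P.IsCrystallographic]

lemma pairingIn_reflect_self (γ : ι) (α : LongRoot b B a) :
    P.pairingIn ℤ (reflect γ α).idx γ = -P.pairingIn ℤ α.idx γ := by
  rw [idx_reflect, pairingIn_reflectionPerm_left, pairingIn_same]; ring

lemma reflect_eq_self {γ : ι} {α : LongRoot b B a} (h : P.pairingIn ℤ α.idx γ = 0) :
    reflect γ α = α :=
  idx_injective (reflectionPerm_eq_of_pairingIn_eq_zero h)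

variable [Finite ι] [P.IsReduced]

lemma level_lt_level_reflect {γ : ι} (hγ : b.IsPos γ) {α : LongRoot b B a}
    (h : 0 < P.pairingIn ℤ α.idx γ) : level b a α.idx < level b a (reflect γ α).idx :=
  level_lt_level_reflectionPerm a hγ h

lemma Step.pairingIn_pos {γ : ι} {β α : LongRoot b B a} (h : Step γ β α) :
    0 < P.pairingIn ℤ β.idx γ := by
  obtain ⟨h1, h2, h3⟩ := h
  rcases lt_trichotomy (P.pairingIn ℤ β.idx γ) 0 with hc | hc | hc
  · have := level_reflectionPerm_lt_level a h1 hc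
    rw [← h2] at this; omega
  · rw [reflectionPerm_eq_of_pairingIn_eq_zero hc] at h2
    rw [h2] at h3; omega
  · exact hc

lemma level_reflect_of_mem_support (hpos : ∀ v : V, v ≠ 0 → 0 < B.form v v) {δ : ι}
    (hδ : δ ∈ b.support) {α : LongRoot b B a} (h : 0 < P.pairingIn ℤ α.idx δ) :
    level b a (reflect δ α).idx = level b a α.idx + 1 :=
  level_reflectionPerm_of_mem_support hpos a hδ α.isLong h

lemma step_reflect_of_mem_support (hpos : ∀ v : V, v ≠ 0 → 0 < B.form v v) {δ : ι}
    (hδ : δ ∈ b.support) {α : LongRoot b B a} (h : 0 < P.pairingIn ℤ α.idx δ) :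
    Step δ α (reflect δ α) :=
  ⟨Base.isPos_of_mem_support hδ, rfl, level_reflect_of_mem_support hpos hδ h⟩

lemma reflect_step_of_mem_support (hpos : ∀ v : V, v ≠ 0 → 0 < B.form v v) {δ : ι}
    (hδ : δ ∈ b.support) {α : LongRoot b B a} (h : P.pairingIn ℤ α.idx δ < 0) :
    Step δ (reflect δ α) α := by
  have := step_reflect_of_mem_support hpos hδ (α := reflect δ α) (by
    rw [pairingIn_reflect_self]; omega)
  rwa [reflect_reflect] at this

/-- The member of `{α, s_δ α}` of the smaller level. -/
noncomputable def lower (δ : ι) (α : LongRoot b B a) : LongRoot b B a :=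
  if P.pairingIn ℤ α.idx δ < 0 then reflect δ α else α

/-- The member of `{α, s_δ α}` of the larger level. -/
noncomputable def upper (δ : ι) (α : LongRoot b B a) : LongRoot b B a :=
  if 0 < P.pairingIn ℤ α.idx δ then reflect δ α else α

omit [Finite ι] [P.IsReduced] in
lemma lower_reflect (δ : ι) (α : LongRoot b B a) : lower δ (reflect δ α) = lower δ α := by
  rcases lt_trichotomy (P.pairingIn ℤ α.idx δ) 0 with hc | hc | hc
  · rw [lower, lower, pairingIn_reflect_self, if_neg (by omega), if_pos hc]
  · rw [reflect_eq_self hc]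
  · rw [lower, lower, pairingIn_reflect_self, if_pos (by omega), if_neg (by omega),
      reflect_reflect]

omit [Finite ι] [P.IsReduced] in
lemma upper_reflect (δ : ι) (α : LongRoot b B a) : upper δ (reflect δ α) = upper δ α := by
  rcases lt_trichotomy (P.pairingIn ℤ α.idx δ) 0 with hc | hc | hc
  · rw [upper, upper, pairingIn_reflect_self, if_pos (by omega), if_neg (by omega),
      reflect_reflect]
  · rw [reflect_eq_self hc]
  · rw [upper, upper, pairingIn_reflect_self, if_neg (by omega), if_pos hc]

lemma path_lower (hpos : ∀ v : V, v ≠ 0 → 0 < B.form v v) {δ : ι} (hδ : δ ∈ b.support)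
    (α : LongRoot b B a) : Path (lower δ α) α := by
  rw [lower]
  split_ifs with h
  · exact (reflect_step_of_mem_support hpos hδ h).path
  · exact ReflTransGen.refl

lemma path_upper (hpos : ∀ v : V, v ≠ 0 → 0 < B.form v v) {δ : ι} (hδ : δ ∈ b.support)
    (α : LongRoot b B a) : Path α (upper δ α) := by
  rw [upper]
  split_ifs with h
  · exact (step_reflect_of_mem_support hpos hδ h).path
  · exact ReflTransGen.refl

/-- A step through `γ ≠ δ` is compared with its image under `s_δ`. -/
lemma Step.level_reflect_lt {γ δ : ι} (hδ : δ ∈ b.support) (hne : γ ≠ δ) {β α : LongRoot b B a}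
    (h : Step γ β α) : level b a (reflect δ β).idx < level b a (reflect δ α).idx := by
  have h1 := level_lt_level_reflect (h.1.reflectionPerm hδ hne) (α := reflect δ β) (by
    rw [idx_reflect, pairingIn_reflectionPerm_reflectionPerm]; exact h.pairingIn_pos)
  rwa [reflect_reflectionPerm, ← h.eq_reflect] at h1

lemma Step.reflect {γ δ : ι} (hδ : δ ∈ b.support) (hne : γ ≠ δ) {β α : LongRoot b B a}
    (h : Step γ β α)
    (hl : level b a (LongRoot.reflect δ α).idx = level b a (LongRoot.reflect δ β).idx + 1) :
    Step (P.reflectionPerm δ γ) (LongRoot.reflect δ β) (LongRoot.reflect δ α) := by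
  refine ⟨h.1.reflectionPerm hδ hne, ?_, hl⟩
  rw [h.eq_reflect, ← reflect_reflectionPerm]
  rfl

/-- The lifting property. If `s_δ` lowers `α`, comparing the levels of the reflected roots forces it
to lower `β` too, and the reflected step is again a step. If not, `lower δ β`, `β`, `α` already form
a path. -/
lemma Step.path_lower (hpos : ∀ v : V, v ≠ 0 → 0 < B.form v v) {δ : ι} (hδ : δ ∈ b.support)
    {γ : ι} {β α : LongRoot b B a} (h : Step γ β α) : Path (lower δ β) (lower δ α) := by
  by_cases hne : γ = δ
  · subst hne
    rw [h.eq_reflect, lower_reflect]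
    exact ReflTransGen.refl
  by_cases hα : P.pairingIn ℤ α.idx δ < 0
  · have hlt := h.level_reflect_lt hδ hne
    have hlα := (reflect_step_of_mem_support hpos hδ hα).2.2
    have hl := h.2.2
    have hβ : P.pairingIn ℤ β.idx δ < 0 := by
      by_contra hc
      rcases (not_lt.1 hc).eq_or_lt with h0 | h0
      · rw [reflect_eq_self h0.symm] at hlt
        omega
      · have := level_reflect_of_mem_support hpos hδ h0
        omega
    have hlβ := (reflect_step_of_mem_support hpos hδ hβ).2.2
    rw [lower, lower, if_pos hα, if_pos hβ]
    exact (h.reflect hδ hne (by omega)).path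
  · have e : lower δ α = α := if_neg hα
    rw [e]
    exact (LongRoot.path_lower hpos hδ β).trans h.path

lemma Step.path_upper (hpos : ∀ v : V, v ≠ 0 → 0 < B.form v v) {δ : ι} (hδ : δ ∈ b.support)
    {γ : ι} {β α : LongRoot b B a} (h : Step γ β α) : Path (upper δ β) (upper δ α) := by
  by_cases hne : γ = δ
  · subst hne
    rw [h.eq_reflect, upper_reflect]
    exact ReflTransGen.refl
  by_cases hβ : 0 < P.pairingIn ℤ β.idx δ
  · have hlt := h.level_reflect_lt hδ hne
    have hlβ := level_reflect_of_mem_support hpos hδ hβ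
    have hl := h.2.2
    have hα : 0 < P.pairingIn ℤ α.idx δ := by
      by_contra hc
      rcases (not_lt.1 hc).eq_or_lt with h0 | h0
      · rw [reflect_eq_self h0] at hlt
        omega
      · have := (reflect_step_of_mem_support hpos hδ h0).2.2
        omega
    have hlα := level_reflect_of_mem_support hpos hδ hα
    rw [upper, upper, if_pos hα, if_pos hβ]
    exact (h.reflect hδ hne (by omega)).path
  · have e : upper δ β = β := if_neg hβ
    rw [e]
    exact ReflTransGen.trans h.path (LongRoot.path_upper hpos hδ α)

lemma Path.lower (hpos : ∀ v : V, v ≠ 0 → 0 < B.form v v) {δ : ι} (hδ : δ ∈ b.support)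
    {β α : LongRoot b B a} (h : Path β α) : Path (lower δ β) (lower δ α) := by
  induction h with
  | refl => exact ReflTransGen.refl
  | tail _ hs ih => exact ReflTransGen.trans ih (hs.choose_spec.path_lower hpos hδ)

lemma Path.upper (hpos : ∀ v : V, v ≠ 0 → 0 < B.form v v) {δ : ι} (hδ : δ ∈ b.support)
    {β α : LongRoot b B a} (h : Path β α) : Path (upper δ β) (upper δ α) := by
  induction h with
  | refl => exact ReflTransGen.refl
  | tail _ hs ih => exact ReflTransGen.trans ih (hs.choose_spec.path_upper hpos hδ)

/-- Reflecting a long root in a positive root with which it makes an acute angle yields a root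
which can be reached by a path. -/
theorem path_reflect (hpos : ∀ v : V, v ≠ 0 → 0 < B.form v v) {γ : ι} (hγ : b.IsPos γ)
    {β : LongRoot b B a} (h : 0 < P.pairingIn ℤ β.idx γ) : Path β (reflect γ β) := by
  induction hn : (b.height γ).toNat using Nat.strong_induction_on generalizing γ β with
  | _ n ih =>
    by_cases hs : γ ∈ b.support
    · exact (step_reflect_of_mem_support hpos hs h).path
    -- Conjugating by a simple `s_δ` at an acute angle to `γ` lowers the height of `γ`; induction
    -- then gives a path from `s_δ β` to `s_δ s_γ β`.
    obtain ⟨δ, hδ, hp⟩ := hγ.exists_mem_support_pos_pairingIn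
    have hp' := (P.zero_lt_pairingIn_iff' ℤ).1 hp
    have hne : γ ≠ δ := fun e => hs (e ▸ hδ)
    have hγ' := hγ.reflectionPerm hδ hne
    have hlt : (b.height (P.reflectionPerm δ γ)).toNat < n := by
      have h1 := height_reflectionPerm b δ γ
      rw [Base.height_one_of_mem_support hδ] at h1
      rw [Base.isPos_iff] at hγ hγ'
      omega
    have hpath := ih _ hlt hγ' (β := reflect δ β) (by
      rwa [idx_reflect, pairingIn_reflectionPerm_reflectionPerm]) rfl
    rw [reflect_reflectionPerm] at hpath
    have hα : P.pairingIn ℤ (reflect γ β).idx δ =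
        P.pairingIn ℤ β.idx δ - P.pairingIn ℤ β.idx γ * P.pairingIn ℤ γ δ :=
      pairingIn_reflectionPerm_left _ _ _
    have hmul := mul_pos h hp'
    -- If `s_γ β` pairs positively with `δ`, so does `β`, and `lower` undoes `s_δ` at both ends of
    -- the path. Otherwise `upper` fixes `s_γ β`, and `β` is joined to its own `upper`.
    by_cases hc : 0 < P.pairingIn ℤ (reflect γ β).idx δ
    · have := hpath.lower hpos hδ
      rw [lower_reflect, lower_reflect] at this
      have e1 : LongRoot.lower δ β = β := if_neg (by omega)
      have e2 : LongRoot.lower δ (LongRoot.reflect γ β) = LongRoot.reflect γ β :=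
        if_neg (by omega)
      rwa [e1, e2] at this
    · have := hpath.upper hpos hδ
      rw [upper_reflect, upper_reflect] at this
      have e : LongRoot.upper δ (LongRoot.reflect γ β) = LongRoot.reflect γ β := if_neg hc
      rw [e] at this
      exact ReflTransGen.trans (path_upper hpos hδ β) this

/-- If the root of a step is not simple, then the step leads from a simple root to the opposite of
a simple root, and its root pairs to one with the initial coroot. -/
lemma Step.eq_of_notMem_support {γ : ι} {β α : LongRoot b B a} (h : Step γ β α) (hγ : γ ∉ b.support) :
    β.idx ∈ b.support ∧ P.reflectionPerm α.idx α.idx ∈ b.support ∧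
      P.pairingIn ℤ γ β.idx = 1 := by
  have h0 := dualHeight_ne_zero b β.idx
  have h1 := dualHeight_ne_zero b α.idx
  have h2 := dualHeight_reflectionPerm b γ β.idx
  have h3 : dualHeight b γ ≠ 1 := fun e => hγ (mem_support_of_dualHeight_eq_one e)
  have h4 := isPos_iff_dualHeight_pos.1 h.1
  have h5 := (P.zero_lt_pairingIn_iff' ℤ).1 h.pairingIn_pos
  have h6 := h.2.2
  rw [← h.2.1] at h2
  have h7 : dualHeight b (P.reflectionPerm α.idx α.idx) = -dualHeight b α.idx :=
    b.flip.height_reflectionPerm_self α.idx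
  -- A non-simple `γ` has dual height at least two, so the dual height drops by at least two. A
  -- level change of one then forces a passage from 1 to -1.
  have h8 : P.pairingIn ℤ γ β.idx * 2 ≤ P.pairingIn ℤ γ β.idx * dualHeight b γ :=
    mul_le_mul_of_nonneg_left (by omega) h5.le
  simp only [level, isPos_iff_dualHeight_pos] at h6
  have h9 : dualHeight b β.idx = 1 ∧ dualHeight b α.idx = -1 ∧
      P.pairingIn ℤ γ β.idx = 1 := by
    split_ifs at h6 <;> omega
  exact ⟨mem_support_of_dualHeight_eq_one h9.1,
    mem_support_of_dualHeight_eq_one (by rw [h7, h9.2.1]; rfl), h9.2.2⟩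

/-- If a step leads from a simple root to the opposite of a simple root, then either its root is
simple, or the initial root pairs to one with its coroot. -/
lemma Step.pairingIn_eq_one_of_notMem_support {γ : ι} {β α : LongRoot b B a} (h : Step γ β α)
    (hγ : γ ∉ b.support) (hβ : β.idx ∈ b.support)
    (hα : P.reflectionPerm α.idx α.idx ∈ b.support) : P.pairingIn ℤ β.idx γ = 1 := by
  have h1 := height_reflectionPerm b γ β.idx
  have h2 : b.height (P.reflectionPerm α.idx α.idx) = -b.height α.idx :=
    b.height_reflectionPerm_self α.idx
  have h3 : b.height γ ≠ 1 := fun e => hγ (mem_support_of_height_eq_one e)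
  have h4 := (Base.isPos_iff b).1 h.1
  rw [← h.2.1, Base.height_one_of_mem_support hβ] at h1
  rw [Base.height_one_of_mem_support hα] at h2
  have h5 := h.pairingIn_pos
  -- Here the ordinary height drops from 1 to -1, in multiples of a height that is at least two.
  have h6 : P.pairingIn ℤ β.idx γ * 2 ≤ P.pairingIn ℤ β.idx γ * b.height γ :=
    mul_le_mul_of_nonneg_left (by omega) h5.le
  omega

/-- The reflection of a step preserves the positivity of the roots orthogonal to the initial root
of the step. -/
theorem Step.isPos_reflectionPerm {γ θ : ι} {β α : LongRoot b B a} (h : Step γ β α) (hθ : b.IsPos θ)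
    (horth : P.pairingIn ℤ θ β.idx = 0) : b.IsPos (P.reflectionPerm γ θ) := by
  have hp := (P.zero_lt_pairingIn_iff' ℤ).1 h.pairingIn_pos
  by_cases hγ : γ ∈ b.support
  · exact hθ.reflectionPerm hγ (by rintro rfl; omega)
  obtain ⟨hβ, hα, hm⟩ := h.eq_of_notMem_support hγ
  have hc := h.pairingIn_eq_one_of_notMem_support hγ hβ hα
  -- With `δ = -α` simple, `γ^∨ = β^∨ + δ^∨` and `γ = s_β δ`. As `s_β` fixes `θ`, `s_γ θ = s_β s_δ
  -- θ`, and both simple reflections preserve positivity once `θ ≠ δ` and `s_δ θ ≠ β`.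
  set δ := P.reflectionPerm α.idx α.idx with hδ
  have hcoδ : P.coroot δ = P.coroot γ - P.coroot β.idx := by
    have h1 := coroot_reflectionPerm_eq_add_zsmul (P := P) γ β.idx
    rw [← h.2.1, hm] at h1
    rw [hδ, coroot_reflectionPerm, coreflection_apply_self, h1]
    module
  have hpδ : P.pairingIn ℤ β.idx δ = -1 := by
    apply FaithfulSMul.algebraMap_injective ℤ ℝ
    rw [algebraMap_pairingIn, ← root_coroot_eq_pairing, hcoδ, map_sub, root_coroot_eq_pairing,
      root_coroot_eq_pairing, pairing_same, ← P.algebraMap_pairingIn ℤ, hc]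
    norm_num
  have hγδ : P.reflectionPerm β.idx δ = γ := by
    apply P.coroot.injective
    rw [coroot_reflectionPerm_eq_add_zsmul, hpδ, hcoδ]
    module
  have hθδ : θ ≠ δ := by
    rintro e
    have : P.pairingIn ℤ δ β.idx < 0 := (P.pairingIn_lt_zero_iff ℤ).1 (by omega)
    rw [← e] at this
    omega
  have h1 := hθ.reflectionPerm hα hθδ
  have h2 : P.reflectionPerm γ θ = P.reflectionPerm β.idx (P.reflectionPerm δ θ) := by
    rw [← reflectionPerm_reflectionPerm_reflectionPerm, hγδ,
      reflectionPerm_eq_of_pairingIn_eq_zero horth]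
  rw [h2]
  refine h1.reflectionPerm hβ fun e => ?_
  -- If `s_δ θ = β`, then `θ = s_δ β` pairs to 2 - 1 = 1 with `β^∨`, against orthogonality.
  have h3 : P.pairingIn ℤ θ β.idx = P.pairingIn ℤ (P.reflectionPerm δ β.idx) β.idx := by
    rw [← e, reflectionPerm_self]
  rw [pairingIn_reflectionPerm_left, hpδ, pairingIn_same] at h3
  have h4 := pairingIn_reflectionPerm_left (P := P) β.idx δ β.idx
  rw [hγδ, pairingIn_same] at h4
  omega

end LongRoot

end LongRoots

namespace LongRoots

open RootPairing Relation

variable {ι V N : Type*} [AddCommGroup V] [Module ℝ V] [AddCommGroup N] [Module ℝ N]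
  {P : RootPairing ι ℝ V N} {b : P.Base} {B : P.InvariantForm} {a : ι}

/-! ### The highest root as the unique dominant long root -/

section Highest

lemma form_nonneg_of_mem_closure {v x : V} (hv : ∀ δ ∈ b.support, 0 ≤ B.form (P.root δ) v)
    (hx : x ∈ AddSubmonoid.closure (P.root '' b.support)) : 0 ≤ B.form x v := by
  induction hx using AddSubmonoid.closure_induction with
  | mem x hx =>
    obtain ⟨δ, hδ, rfl⟩ := hx
    exact hv δ hδ
  | zero => simp
  | add x y _ _ hx hy => rw [map_add, LinearMap.add_apply]; exact add_nonneg hx hy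

lemma coord_nonneg_of_mem_closure [P.IsRootSystem] {x : V}
    (hx : x ∈ AddSubmonoid.closure (P.root '' b.support)) (δ : b.support) :
    0 ≤ b.toWeightBasis.coord δ x := by
  classical
  induction hx using AddSubmonoid.closure_induction with
  | mem x hx =>
    obtain ⟨j, hj, rfl⟩ := hx
    have := b.toWeightBasis_repr_root ⟨j, hj⟩
    simp only [Module.Basis.coord_apply]
    rw [this, Finsupp.single_apply]
    split_ifs <;> simp
  | zero => simp
  | add x y _ _ hx hy => rw [map_add]; exact add_nonneg hx hy

lemma IsPos.root_mem_closure {i : ι} (hi : b.IsPos i) :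
    P.root i ∈ AddSubmonoid.closure (P.root '' b.support) := by
  refine (b.root_mem_or_neg_mem i).resolve_right fun h => ?_
  have key : ∀ x ∈ AddSubmonoid.closure (P.root '' b.support),
      ∃ f : ι → ℕ, x = ∑ j ∈ b.support, f j • P.root j := by
    classical
    intro x hx
    induction hx using AddSubmonoid.closure_induction with
    | mem x hx =>
      obtain ⟨j, hj, rfl⟩ := hx
      exact ⟨Pi.single j 1, by simp [Pi.single_apply, Finset.mem_coe.1 hj]⟩
    | zero => exact ⟨0, by simp⟩
    | add x y _ _ hx hy =>
      obtain ⟨f, rfl⟩ := hx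
      obtain ⟨g, rfl⟩ := hy
      exact ⟨f + g, by simp [add_smul, Finset.sum_add_distrib]⟩
  obtain ⟨f, hf⟩ := key _ h
  have hr : P.root i = ∑ j ∈ b.support, (fun j => -(f j : ℤ)) j • P.root j := by
    rw [← neg_neg (P.root i), hf]
    simp
  rw [Base.isPos_iff, Base.height_eq_sum hr, Finset.sum_neg_distrib] at hi
  have : 0 ≤ ∑ j ∈ b.support, (f j : ℤ) := Finset.sum_nonneg fun _ _ => Int.natCast_nonneg _
  omega

variable [P.IsCrystallographic]

lemma IsHighestRoot.pairingIn_nonneg [P.IsRootSystem] (ha : IsHighestRoot b a) {δ : ι}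
    (hδ : δ ∈ b.support) : 0 ≤ P.pairingIn ℤ a δ := by
  have h := coord_nonneg_of_mem_closure (ha (P.reflectionPerm δ a)) ⟨δ, hδ⟩
  have e : P.root a - P.root (P.reflectionPerm δ a) =
      (P.pairingIn ℤ a δ : ℝ) • P.root δ := by
    rw [root_reflectionPerm_eq_add_zsmul, Int.cast_smul_eq_zsmul]
    module
  have h2 := b.toWeightBasis_repr_root ⟨δ, hδ⟩
  rw [e, map_smul, Module.Basis.coord_apply, h2] at h
  simp only [Finsupp.single_eq_same, smul_eq_mul, mul_one] at h
  exact_mod_cast h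

lemma IsHighestRoot.root_sub_nonneg (hpos : ∀ v : V, v ≠ 0 → 0 < B.form v v)
    (ha : IsHighestRoot b a) {i : ι} (hi : ∀ δ ∈ b.support, 0 ≤ P.pairingIn ℤ i δ) :
    sqLength B i ≤ B.form (P.root a) (P.root i) := by
  have h := form_nonneg_of_mem_closure (B := B) (v := P.root i) (fun δ hδ => by
    rw [← B.symm.eq]
    exact (form_root_root_nonneg_iff hpos i δ).2 (hi δ hδ)) (ha i)
  rw [map_sub, LinearMap.sub_apply] at h
  rw [sqLength]
  linarith

/-- The highest root is the only dominant long root. -/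
lemma IsHighestRoot.eq_of_forall_pairingIn_nonneg [Finite ι]
    (hpos : ∀ v : V, v ≠ 0 → 0 < B.form v v)
    (ha : IsHighestRoot b a) {i : ι} (hl : IsLong B i)
    (hi : ∀ δ ∈ b.support, 0 ≤ P.pairingIn ℤ i δ) : i = a := by
  by_contra hne
  have h1 := ha.root_sub_nonneg hpos hi
  -- Dominance gives `(a|i) ≥ (i|i) ≥ (a|a)`, which is incompatible with `(a - i|a - i) > 0`.
  have h2 := hpos (P.root a - P.root i) (sub_ne_zero.2 fun e => hne (P.root.injective e).symm)
  have h3 : B.form (P.root i) (P.root a) = B.form (P.root a) (P.root i) := B.symm.eq _ _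
  have h4 : sqLength B a ≤ sqLength B i := (sqLength_le_maxSqLength a).trans hl.ge
  simp only [map_sub, LinearMap.sub_apply] at h2
  simp only [sqLength] at h1 h4
  linarith

/-- A long root of minimal level is dominant, since a simple reflection would otherwise lower it; so
it is `a`. -/
lemma IsHighestRoot.isLong [Finite ι] [P.IsReduced]
    (hpos : ∀ v : V, v ≠ 0 → 0 < B.form v v)
    (ha : IsHighestRoot b a) : IsLong B a := by
  have : Nonempty ι := ⟨a⟩
  obtain ⟨i₀, hi₀⟩ := exists_isLong (B := B)
  obtain ⟨i, hi, hmin⟩ :=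
    Set.exists_min_image {i | IsLong B i} (level b a) (Set.toFinite _) ⟨i₀, hi₀⟩
  rw [← ha.eq_of_forall_pairingIn_nonneg hpos hi fun δ hδ => ?_]
  · exact hi
  · by_contra hc
    have h1 := level_reflectionPerm_lt_level a (Base.isPos_of_mem_support hδ) (not_le.1 hc)
    exact absurd (hmin _ (isLong_reflectionPerm.2 hi)) (not_le.2 h1)

variable [P.IsRootSystem]

lemma IsHighestRoot.form_nonneg (hpos : ∀ v : V, v ≠ 0 → 0 < B.form v v)
    (ha : IsHighestRoot b a) {x : V} (hx : x ∈ AddSubmonoid.closure (P.root '' b.support)) :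
    0 ≤ B.form x (P.root a) := by
  refine form_nonneg_of_mem_closure (fun δ hδ => ?_) hx
  rw [← B.symm.eq]
  exact (form_root_root_nonneg_iff hpos a δ).2 (ha.pairingIn_nonneg hδ)

lemma IsHighestRoot.pairingIn_nonneg_of_isPos (hpos : ∀ v : V, v ≠ 0 → 0 < B.form v v)
    (ha : IsHighestRoot b a) {i : ι} (hi : b.IsPos i) : 0 ≤ P.pairingIn ℤ i a :=
  (form_root_root_nonneg_iff hpos i a).1 (ha.form_nonneg hpos (IsPos.root_mem_closure hi))

variable [Finite ι]

lemma IsHighestRoot.isPos (ha : IsHighestRoot b a) : b.IsPos a := by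
  by_contra h
  obtain ⟨δ, hδ, hp⟩ := (isPos_reflectionPerm_self.2 h).exists_mem_support_pos_pairingIn
  rw [pairingIn_reflectionPerm_self_right] at hp
  have h1 := ha.pairingIn_nonneg hδ
  have := (P.pairingIn_lt_zero_iff ℤ (i := δ) (j := a)).1 (by omega)
  omega

lemma IsHighestRoot.level_eq_zero (ha : IsHighestRoot b a) : level b a a = 0 := by
  rw [level, if_pos ha.isPos, sub_self]

end Highest

/-! ### Words, length and exchange in the Weyl group -/

section Weyl

@[simp] lemma weylGroupToPerm_ofIdx (γ : ι) :
    P.weylGroupToPerm (weylGroup.ofIdx P γ) = P.reflectionPerm γ := rfl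

@[simp] lemma ofIdx_mul_self (γ : ι) : weylGroup.ofIdx P γ * weylGroup.ofIdx P γ = 1 := by
  rw [mul_eq_one_iff_eq_inv]
  exact Subtype.ext (Equiv.reflection_inv P γ).symm

lemma ofIdx_reflectionPerm (δ γ : ι) : weylGroup.ofIdx P (P.reflectionPerm δ γ) =
    weylGroup.ofIdx P δ * weylGroup.ofIdx P γ * weylGroup.ofIdx P δ := by
  apply Subtype.ext
  apply Equiv.weightHom_injective P
  change Equiv.weightHom P (Equiv.reflection P _) =
    Equiv.weightHom P (Equiv.reflection P δ * Equiv.reflection P γ * Equiv.reflection P δ)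
  simp only [map_mul, Equiv.weightHom_apply, Equiv.reflection_weightEquiv]
  exact reflection_reflectionPerm P

lemma ofIdx_reflectionPerm_self (γ : ι) :
    weylGroup.ofIdx P (P.reflectionPerm γ γ) = weylGroup.ofIdx P γ := by
  rw [ofIdx_reflectionPerm, ofIdx_mul_self, one_mul]

lemma ofIdx_inv (γ : ι) : (weylGroup.ofIdx P γ)⁻¹ = weylGroup.ofIdx P γ :=
  inv_eq_of_mul_eq_one_left (ofIdx_mul_self γ)

lemma weylGroupToPerm_mul (v w : P.weylGroup) (i : ι) :
    P.weylGroupToPerm (v * w) i = P.weylGroupToPerm v (P.weylGroupToPerm w i) := rfl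

lemma weylGroupToPerm_reflectionPerm_self (w : P.weylGroup) (i : ι) :
    P.weylGroupToPerm w (P.reflectionPerm i i) =
      P.reflectionPerm (P.weylGroupToPerm w i) (P.weylGroupToPerm w i) := by
  apply P.root.injective
  rw [← weylGroup_apply_root, root_reflectionPerm, root_reflectionPerm, reflection_apply_self,
    reflection_apply_self, ← weylGroup_apply_root, smul_neg]

/-- The product of the reflections with the given indices. -/
noncomputable def wordProd (P : RootPairing ι ℝ V N) (l : List ι) : P.weylGroup :=
  (l.map (weylGroup.ofIdx P)).prod

@[simp] lemma wordProd_nil : wordProd P [] = 1 := rfl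

@[simp] lemma wordProd_cons (i : ι) (l : List ι) :
    wordProd P (i :: l) = weylGroup.ofIdx P i * wordProd P l := by
  simp [wordProd]

lemma wordProd_append (l l' : List ι) :
    wordProd P (l ++ l') = wordProd P l * wordProd P l' := by
  simp [wordProd]

lemma length_le {l : List ι} (hl : ∀ i ∈ l, i ∈ b.support) :
    length b (wordProd P l) ≤ l.length :=
  Nat.sInf_le ⟨l, hl, rfl, rfl⟩

lemma length_one (b : P.Base) : length b (1 : P.weylGroup) = 0 :=
  Nat.le_zero.1 (length_le (l := []) (by simp))

variable [P.IsCrystallographic] [Finite ι] [P.IsReduced]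

lemma exists_wordProd_ofIdx (b : P.Base) (γ : ι) :
    ∃ l : List ι, (∀ i ∈ l, i ∈ b.support) ∧ wordProd P l = weylGroup.ofIdx P γ := by
  refine b.induction_reflect (p := fun γ => ∃ l : List ι, (∀ i ∈ l, i ∈ b.support) ∧
    wordProd P l = weylGroup.ofIdx P γ) γ ?_ ?_ ?_
  · rintro i ⟨l, hl, h⟩
    exact ⟨l, hl, h.trans (ofIdx_reflectionPerm_self i).symm⟩
  · intro i hi
    exact ⟨[i], by simpa using hi, by simp⟩
  · rintro i j ⟨l, hl, h⟩ hj
    refine ⟨j :: (l ++ [j]), ?_, ?_⟩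
    · intro k hk
      simp only [List.mem_cons, List.mem_append, List.not_mem_nil, or_false] at hk
      rcases hk with rfl | hk | rfl
      · exact hj
      · exact hl k hk
      · exact hj
    · rw [wordProd_cons, wordProd_append, h, ofIdx_reflectionPerm, mul_assoc]
      simp

lemma exists_wordProd_eq (b : P.Base) (w : P.weylGroup) :
    ∃ l : List ι, (∀ i ∈ l, i ∈ b.support) ∧ wordProd P l = w := by
  obtain ⟨w, hw⟩ := w
  induction hw using weylGroup.induction with
  | mem i => exact exists_wordProd_ofIdx b i
  | one => exact ⟨[], by simp, rfl⟩
  | mul x y hx hy h1 h2 =>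
    obtain ⟨l, hl, h⟩ := h1
    obtain ⟨l', hl', h'⟩ := h2
    refine ⟨l ++ l', fun k hk => (List.mem_append.1 hk).elim (hl k) (hl' k), ?_⟩
    rw [wordProd_append, h, h']
    rfl

lemma exists_reduced_word (b : P.Base) (w : P.weylGroup) :
    ∃ l : List ι, (∀ i ∈ l, i ∈ b.support) ∧ l.length = length b w ∧ wordProd P l = w := by
  obtain ⟨l, hl, h⟩ := exists_wordProd_eq b w
  exact Nat.sInf_mem (s := {n | ∃ l : List ι, (∀ i ∈ l, i ∈ b.support) ∧ l.length = n ∧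
    (l.map (RootPairing.weylGroup.ofIdx P)).prod = w}) ⟨l.length, l, hl, rfl, h⟩

lemma length_ofIdx_mul_le {δ : ι} (hδ : δ ∈ b.support) (w : P.weylGroup) :
    length b (weylGroup.ofIdx P δ * w) ≤ length b w + 1 := by
  obtain ⟨l, hl, hn, rfl⟩ := exists_reduced_word b w
  rw [← hn, ← wordProd_cons]
  exact length_le (l := δ :: l) (by simpa [hδ] using hl)

/-- The strong exchange condition. -/
lemma exists_wordProd_eq_ofIdx_mul {l : List ι}
    (hl : ∀ i ∈ l, i ∈ b.support) {γ : ι} (hγ : b.IsPos γ)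
    (h : ¬ b.IsPos (P.weylGroupToPerm (wordProd P l)⁻¹ γ)) :
    ∃ l' : List ι, (∀ i ∈ l', i ∈ b.support) ∧ l'.length + 1 = l.length ∧
      wordProd P l' = weylGroup.ofIdx P γ * wordProd P l := by
  induction l generalizing γ with
  | nil => exact absurd hγ h
  | cons i t ih =>
    have hi : i ∈ b.support := hl i (by simp)
    have ht : ∀ j ∈ t, j ∈ b.support := fun j hj => hl j (by simp [hj])
    -- If `γ` is the first letter, that letter is deleted. Otherwise `s_i γ` is still positive and
    -- the deletion takes place in the tail.
    by_cases hne : γ = i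
    · subst hne
      exact ⟨t, ht, rfl, by rw [wordProd_cons, ← mul_assoc, ofIdx_mul_self, one_mul]⟩
    · rw [wordProd_cons, mul_inv_rev, weylGroupToPerm_mul, ofIdx_inv,
        weylGroupToPerm_ofIdx] at h
      obtain ⟨t', ht', hn, he⟩ := ih ht (hγ.reflectionPerm hi hne) h
      refine ⟨i :: t', by simpa [hi] using ht', by simp [hn], ?_⟩
      rw [wordProd_cons, wordProd_cons, he, ofIdx_reflectionPerm]
      simp only [← mul_assoc, ofIdx_mul_self, one_mul]

lemma length_ofIdx_mul_lt {γ : ι} (hγ : b.IsPos γ) {w : P.weylGroup}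
    (h : ¬ b.IsPos (P.weylGroupToPerm w⁻¹ γ)) :
    length b (weylGroup.ofIdx P γ * w) < length b w := by
  obtain ⟨l, hl, hn, rfl⟩ := exists_reduced_word b w
  obtain ⟨l', hl', hn', he⟩ := exists_wordProd_eq_ofIdx_mul hl hγ h
  rw [← he, ← hn, ← hn']
  exact Nat.lt_succ_of_le (length_le hl')

/-- An element of the Weyl group which preserves the positive roots is the identity. -/
theorem eq_one_of_forall_isPos {w : P.weylGroup}
    (h : ∀ i, b.IsPos i → b.IsPos (P.weylGroupToPerm w i)) : w = 1 := by
  obtain ⟨l, hl, hn, rfl⟩ := exists_reduced_word b w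
  rcases l with _ | ⟨i, t⟩
  · rfl
  exfalso
  have hi : i ∈ b.support := hl i (by simp)
  have hpi : b.IsPos i := Base.isPos_of_mem_support hi
  have ht : ∀ j ∈ t, j ∈ b.support := fun j hj => hl j (by simp [hj])
  set w := wordProd P (i :: t) with hw
  -- Since `w` preserves positivity, `w⁻¹ i` is positive, so the tail `t` has `t⁻¹ i` negative. Then
  -- `w = s_i t` is shorter than `t`, against reducedness.
  have h1 : b.IsPos (P.weylGroupToPerm w⁻¹ i) := by
    by_contra hc
    have h2 := h _ (isPos_reflectionPerm_self.2 hc)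
    rw [weylGroupToPerm_reflectionPerm_self, ← weylGroupToPerm_mul, mul_inv_cancel,
      isPos_reflectionPerm_self] at h2
    exact h2 hpi
  have h3 : ¬ b.IsPos (P.weylGroupToPerm (wordProd P t)⁻¹ i) := by
    have e : (wordProd P t)⁻¹ = w⁻¹ * weylGroup.ofIdx P i := by
      rw [hw, wordProd_cons, mul_inv_rev, inv_mul_cancel_right]
    rw [e, weylGroupToPerm_mul, weylGroupToPerm_ofIdx, weylGroupToPerm_reflectionPerm_self,
      isPos_reflectionPerm_self, not_not]
    exact h1
  have h4 := length_ofIdx_mul_lt hpi h3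
  rw [← wordProd_cons, ← hw, ← hn] at h4
  have h5 := length_le (P := P) ht
  simp only [List.length_cons] at h4
  omega

omit [P.IsCrystallographic] [Finite ι] [P.IsReduced] in
lemma isLong_weylGroupToPerm (w : P.weylGroup) {i : ι} (h : IsLong B i) :
    IsLong B (P.weylGroupToPerm w i) := by
  rw [IsLong, sqLength, ← weylGroup_apply_root, InvariantForm.apply_weylGroup_smul]
  exact h

omit [Finite ι] [P.IsReduced] in
lemma pairingIn_weylGroupToPerm (w : P.weylGroup) (i j : ι) :
    P.pairingIn ℤ (P.weylGroupToPerm w i) (P.weylGroupToPerm w j) = P.pairingIn ℤ i j := by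
  obtain ⟨w, hw⟩ := w
  induction hw using weylGroup.induction generalizing i j with
  | mem k => exact pairingIn_reflectionPerm_reflectionPerm k i j
  | one => rfl
  | mul x y hx hy h1 h2 => exact (h1 _ _).trans (h2 i j)

/-- The level of `w(a)` is at most the length of `w`. -/
lemma level_le_length [P.IsRootSystem] (hpos : ∀ v : V, v ≠ 0 → 0 < B.form v v)
    (ha : IsHighestRoot b a) (w : P.weylGroup) :
    level b a (P.weylGroupToPerm w a) ≤ length b w := by
  obtain ⟨l, hl, hn, rfl⟩ := exists_reduced_word b w
  rw [← hn]
  clear hn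
  induction l with
  | nil => exact ha.level_eq_zero.le
  | cons i t ih =>
    have hi : i ∈ b.support := hl i (by simp)
    have h1 := ih fun j hj => hl j (by simp [hj])
    rw [wordProd_cons, weylGroupToPerm_mul, weylGroupToPerm_ofIdx, List.length_cons]
    set k := P.weylGroupToPerm (wordProd P t) a with hk
    have hlong : IsLong B k := isLong_weylGroupToPerm _ (ha.isLong hpos)
    push_cast
    rcases lt_trichotomy (P.pairingIn ℤ k i) 0 with hc | hc | hc
    · have := level_reflectionPerm_lt_level a (Base.isPos_of_mem_support hi) hc
      omega
    · rw [reflectionPerm_eq_of_pairingIn_eq_zero hc]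
      omega
    · rw [level_reflectionPerm_of_mem_support hpos a hi hlong hc]
      omega

end Weyl

/-! ### Minimal representatives and the image of the highest root -/

section MinRep

variable [P.IsCrystallographic]

lemma form_eq_zero_iff_pairingIn {i : ι} :
    B.form (P.root a) (P.root i) = 0 ↔ P.pairingIn ℤ i a = 0 := by
  rw [B.apply_root_root_zero_iff, P.pairing_eq_zero_iff', ← P.algebraMap_pairingIn ℤ]
  simp

variable [P.IsRootSystem]

/-- Pairings of `a` with simple roots are nonnegative, so in a sum of simple roots orthogonal to `a`
every term is orthogonal to `a`. -/
lemma root_mem_span_orthSimple_iff (hpos : ∀ v : V, v ≠ 0 → 0 < B.form v v)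
    (ha : IsHighestRoot b a) {i : ι} (hi : b.IsPos i) :
    P.root i ∈ Submodule.span ℝ (P.root '' orthSimple b B a) ↔ P.pairingIn ℤ i a = 0 := by
  rw [← form_eq_zero_iff_pairingIn (B := B)]
  constructor
  · generalize P.root i = x
    intro h
    induction h using Submodule.span_induction with
    | mem x hx =>
      obtain ⟨j, hj, rfl⟩ := hx
      exact hj.2
    | zero => simp
    | add x y _ _ hx hy => rw [map_add, hx, hy, add_zero]
    | smul c x _ hx => rw [map_smul, hx, smul_zero]
  · have key : ∀ x ∈ AddSubmonoid.closure (P.root '' b.support),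
        B.form x (P.root a) = 0 → x ∈ Submodule.span ℝ (P.root '' orthSimple b B a) := by
      intro x hx
      induction hx using AddSubmonoid.closure_induction with
      | mem x hx =>
        obtain ⟨j, hj, rfl⟩ := hx
        exact fun h => Submodule.subset_span ⟨j, ⟨hj, (B.symm.eq _ _).symm.trans h⟩, rfl⟩
      | zero => simp
      | add x y hx hy h1 h2 =>
        intro h
        have h3 := ha.form_nonneg hpos hx
        have h4 := ha.form_nonneg hpos hy
        rw [map_add, LinearMap.add_apply] at h
        exact add_mem (h1 (by linarith)) (h2 (by linarith))
    intro h
    exact key _ (IsPos.root_mem_closure hi) ((B.symm.eq _ _).symm.trans h)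

lemma isMinRep_iff (hpos : ∀ v : V, v ≠ 0 → 0 < B.form v v) (ha : IsHighestRoot b a)
    {w : P.weylGroup} : IsMinRep b (orthSimple b B a) w ↔
      ∀ i, b.IsPos i → P.pairingIn ℤ i a = 0 → b.IsPos (P.weylGroupToPerm w i) :=
  ⟨fun h i hi hp => h i ((root_mem_span_orthSimple_iff hpos ha hi).2 hp) hi,
    fun h i hs hi => h i hi ((root_mem_span_orthSimple_iff hpos ha hi).1 hs)⟩

variable [Finite ι] [P.IsReduced]

/-- An element of `X_I` is determined by the image of the highest root. -/
theorem IsMinRep.eq_of_weylGroupToPerm_eq (hpos : ∀ v : V, v ≠ 0 → 0 < B.form v v)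
    (ha : IsHighestRoot b a) {x y : P.weylGroup} (hx : IsMinRep b (orthSimple b B a) x)
    (hy : IsMinRep b (orthSimple b B a) y)
    (h : P.weylGroupToPerm x a = P.weylGroupToPerm y a) : x = y := by
  rw [isMinRep_iff hpos ha] at hx hy
  have hu : P.weylGroupToPerm (x⁻¹ * y) a = a := by
    rw [weylGroupToPerm_mul, ← h, ← weylGroupToPerm_mul, inv_mul_cancel]
    rfl
  have hpair : ∀ i, P.pairingIn ℤ (P.weylGroupToPerm (x⁻¹ * y) i) a = P.pairingIn ℤ i a := by
    intro i
    have := pairingIn_weylGroupToPerm (x⁻¹ * y) i a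
    rwa [hu] at this
  -- A positive `i` made negative by `u = x⁻¹y` is orthogonal to `a`, because `u` preserves the
  -- pairing with `a`. Then `x` sends `-u(i)` to a positive root, yet `x u(i) = y(i)` is positive.
  refine (inv_mul_eq_one.1 (eq_one_of_forall_isPos (b := b) fun i hi => ?_))
  by_contra hc
  have hc' := isPos_reflectionPerm_self.2 hc
  have h1 := ha.pairingIn_nonneg_of_isPos hpos hi
  have h2 := ha.pairingIn_nonneg_of_isPos hpos hc'
  rw [pairingIn_reflectionPerm_self_left, hpair] at h2
  have h3 : P.pairingIn ℤ i a = 0 := by omega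
  have h4 := hx _ hc' (by rw [pairingIn_reflectionPerm_self_left, hpair, h3, neg_zero])
  rw [weylGroupToPerm_reflectionPerm_self, ← weylGroupToPerm_mul, mul_inv_cancel_left,
    isPos_reflectionPerm_self] at h4
  exact h4 (hy i hi h3)

/-- Steps of long roots lift to `X_I`. -/
theorem IsMinRep.ofIdx_mul (hpos : ∀ v : V, v ≠ 0 → 0 < B.form v v)
    (ha : IsHighestRoot b a) {x : P.weylGroup} (hx : IsMinRep b (orthSimple b B a) x)
    {γ : ι} {β α : LongRoot b B a} (h : LongRoot.Step γ β α)
    (hβ : P.weylGroupToPerm x a = β.idx) :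
    IsMinRep b (orthSimple b B a) (weylGroup.ofIdx P γ * x) := by
  rw [isMinRep_iff hpos ha] at hx ⊢
  intro i hi hp
  rw [weylGroupToPerm_mul, weylGroupToPerm_ofIdx]
  refine h.isPos_reflectionPerm (hx i hi hp) ?_
  rw [← hβ, pairingIn_weylGroupToPerm, hp]

/-- Descent on the level: a long root other than `a` is lowered by a simple reflection, and the step
back up lifts to X at the cost of one letter. -/
theorem exists_isMinRep (hpos : ∀ v : V, v ≠ 0 → 0 < B.form v v)
    (ha : IsHighestRoot b a) (α : LongRoot b B a) :
    ∃ x : P.weylGroup, IsMinRep b (orthSimple b B a) x ∧ P.weylGroupToPerm x a = α.idx ∧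
      (length b x : ℤ) ≤ level b a α.idx := by
  by_contra hbad
  have : Finite (LongRoot b B a) := Subtype.finite
  obtain ⟨β, hβ, hmin⟩ := Set.exists_min_image {α : LongRoot b B a |
    ¬ ∃ x : P.weylGroup, IsMinRep b (orthSimple b B a) x ∧ P.weylGroupToPerm x a = α.idx ∧
      (length b x : ℤ) ≤ level b a α.idx} (fun α => level b a α.idx) (Set.toFinite _) ⟨α, hbad⟩
  apply hβ
  by_cases he : β.idx = a
  · refine ⟨1, fun i _ hi => hi, he.symm, ?_⟩
    rw [length_one, he, ha.level_eq_zero]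
    rfl
  · have : ∃ δ ∈ b.support, P.pairingIn ℤ β.idx δ < 0 := by
      by_contra! hc
      exact he (ha.eq_of_forall_pairingIn_nonneg hpos β.isLong hc)
    obtain ⟨δ, hδ, hp⟩ := this
    have hs := LongRoot.reflect_step_of_mem_support hpos hδ hp
    have hgood : ∃ x : P.weylGroup, IsMinRep b (orthSimple b B a) x ∧
        P.weylGroupToPerm x a = (LongRoot.reflect δ β).idx ∧
        (length b x : ℤ) ≤ level b a (LongRoot.reflect δ β).idx := by
      by_contra hc
      have := hmin _ hc
      have := hs.2.2
      omega
    obtain ⟨x, hx, hxa, hlen⟩ := hgood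
    refine ⟨weylGroup.ofIdx P δ * x, hx.ofIdx_mul hpos ha hs hxa, ?_, ?_⟩
    · rw [weylGroupToPerm_mul, hxa, weylGroupToPerm_ofIdx, LongRoot.idx_reflect,
        reflectionPerm_self]
    · have h1 := length_ofIdx_mul_le hδ x
      have h2 := hs.2.2
      omega

/-- One inequality holds for all Weyl group elements; the other holds for the representative built
by descent, which is `x` by uniqueness. -/
lemma IsMinRep.length_eq_level (hpos : ∀ v : V, v ≠ 0 → 0 < B.form v v)
    (ha : IsHighestRoot b a) {x : P.weylGroup} (hx : IsMinRep b (orthSimple b B a) x) :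
    (length b x : ℤ) = level b a (P.weylGroupToPerm x a) := by
  refine le_antisymm ?_ (level_le_length hpos ha x)
  obtain ⟨y, hy, hya, hlen⟩ := exists_isMinRep hpos ha
    (⟨_, isLong_weylGroupToPerm x (ha.isLong hpos)⟩ : LongRoot b B a)
  rw [hx.eq_of_weylGroupToPerm_eq hpos ha hy hya.symm]
  rw [hya]
  exact hlen

end MinRep

end LongRoots

namespace LongRoots

open RootPairing Relation

variable {ι V N : Type*} [AddCommGroup V] [Module ℝ V] [AddCommGroup N] [Module ℝ N]
  {P : RootPairing ι ℝ V N} {b : P.Base} {B : P.InvariantForm} {a : ι}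
  [P.IsCrystallographic] [Finite ι] [P.IsReduced]

/-! ### The integers attached to steps -/

section Coefficients

lemma LongRoot.Step.eq_or_mem_range {γ : ι} {β α : LongRoot b B a} (h : LongRoot.Step γ β α)
    (hβ : β.idx ∈ b.support) (hα : P.reflectionPerm α.idx α.idx ∈ b.support) :
    (γ = β.idx ∧ P.root α.idx = -P.root β.idx) ∨
      (P.pairingIn ℤ β.idx γ = 1 ∧ P.root β.idx - P.root α.idx = P.root γ) := by
  by_cases hγ : γ ∈ b.support
  · left
    have he : γ = β.idx := by
      by_contra hne
      have h1 := (Base.isPos_of_mem_support hβ).reflectionPerm hγ (Ne.symm hne)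
      rw [← h.2.1] at h1
      exact isPos_reflectionPerm_self.1 (Base.isPos_of_mem_support hα) h1
    refine ⟨he, ?_⟩
    rw [h.2.1, he, root_reflectionPerm, reflection_apply_self]
  · right
    have h1 := h.pairingIn_eq_one_of_notMem_support hγ hβ hα
    refine ⟨h1, ?_⟩
    rw [h.2.1, root_reflectionPerm_eq_add_zsmul, h1]
    module

/-- This makes the two alternatives for a step from a simple root to the opposite of one mutually
exclusive. -/
lemma two_smul_root_ne (i k : ι) : P.root k ≠ P.root i + P.root i := by
  intro h
  have h1 : P.pairingIn ℤ k i = 4 := by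
    have := pairingIn_eq_add_of_root_eq_add (S := ℤ) (P := P) (l := i) (j := i) h
    rw [this, pairingIn_same]
    rfl
  have := P.pairingIn_pairingIn_mem_set_of_isCrystal_of_isRed k i
  simp [h1] at this

lemma LongRoot.Step.pairingIn_eq_two {γ : ι} {β α : LongRoot b B a} (h : LongRoot.Step γ β α)
    (hβ : β.idx ∈ b.support) (hα : P.reflectionPerm α.idx α.idx ∈ b.support)
    (e : P.root α.idx = -P.root β.idx) : P.pairingIn ℤ β.idx γ = 2 := by
  rcases h.eq_or_mem_range hβ hα with ⟨hγ, -⟩ | ⟨-, hr⟩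
  · rw [hγ, pairingIn_same]
  · rw [e, sub_neg_eq_add] at hr
    exact absurd hr.symm (two_smul_root_ne _ _)

lemma LongRoot.Step.pairingIn_eq_one {γ : ι} {β α : LongRoot b B a} (h : LongRoot.Step γ β α)
    (hβ : β.idx ∈ b.support) (hα : P.reflectionPerm α.idx α.idx ∈ b.support)
    (e : P.root β.idx - P.root α.idx ∈ Set.range P.root) : P.pairingIn ℤ β.idx γ = 1 := by
  rcases h.eq_or_mem_range hβ hα with ⟨-, hr⟩ | ⟨h1, -⟩
  · obtain ⟨k, hk⟩ := e
    rw [hr, sub_neg_eq_add] at hk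
    exact absurd hk (two_smul_root_ne _ _)
  · exact h1

lemma LongRoot.Step.pairingIn_swap_eq_one (hpos : ∀ v : V, v ≠ 0 → 0 < B.form v v) {γ : ι}
    {β α : LongRoot b B a} (h : LongRoot.Step γ β α)
    (hn : ¬ (β.idx ∈ b.support ∧ P.reflectionPerm α.idx α.idx ∈ b.support)) :
    P.pairingIn ℤ γ β.idx = 1 := by
  refine pairingIn_eq_one_of_isLong hpos β.isLong (fun e => hn ?_) h.pairingIn_pos
  by_cases hγ : γ ∈ b.support
  · refine ⟨e ▸ hγ, ?_⟩
    rw [h.2.1, ← e]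
    convert! hγ
    apply P.root.injective
    rw [root_reflectionPerm, reflection_apply_self, root_reflectionPerm, reflection_apply_self,
      neg_neg]
  · exact ⟨(h.eq_of_notMem_support hγ).1, (h.eq_of_notMem_support hγ).2.1⟩

lemma LongRoot.Step.pairingIn_mul_sqLength (hpos : ∀ v : V, v ≠ 0 → 0 < B.form v v) {γ : ι}
    {β α : LongRoot b B a} (h : LongRoot.Step γ β α)
    (hn : ¬ (β.idx ∈ b.support ∧ P.reflectionPerm α.idx α.idx ∈ b.support)) :
    (P.pairingIn ℤ β.idx γ : ℝ) * sqLength B γ = maxSqLength B := by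
  rw [LongRoots.pairingIn_mul_sqLength, h.pairingIn_swap_eq_one hpos hn, Int.cast_one, one_mul]
  exact β.isLong

/-- An irreducible system has at most two root lengths, so a root that is not long has the minimal
one. -/
lemma sqLength_eq_one_of_not_isLong [P.IsIrreducible]
    (hmin : IsLeast (Set.range (sqLength B)) 1) {γ : ι} (hγ : ¬ IsLong B γ) :
    sqLength B γ = 1 := by
  have : Nonempty ι := ⟨γ⟩
  obtain ⟨i, hi⟩ := hmin.1
  obtain ⟨j, hj⟩ := exists_isLong (B := B)
  have hle := hmin.2 (Set.mem_range_self γ)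
  by_cases hr : sqLength B i = sqLength B j
  · refine le_antisymm ?_ hle
    rw [← hi, hr, hj]
    exact sqLength_le_maxSqLength γ
  · rcases B.apply_eq_or_of_apply_ne hr γ with h | h
    · exact h.trans hi
    · exact absurd (h.trans hj) hγ

end Coefficients

/-! ### Bruhat order against path order -/

section Order

variable [P.IsRootSystem]

/-- The Bruhat order on the Weyl group maps to the path order on the long roots. -/
theorem BruhatLE.path (hpos : ∀ v : V, v ≠ 0 → 0 < B.form v v) {w w' : P.weylGroup}
    (ha : IsHighestRoot b a) (h : BruhatLE b w w') {β α : LongRoot b B a}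
    (hβ : P.weylGroupToPerm w a = β.idx) (hα : P.weylGroupToPerm w' a = α.idx) :
    LongRoot.Path β α := by
  induction h generalizing α with
  | refl =>
    rw [LongRoot.idx_injective (hβ.symm.trans hα)]
    exact ReflTransGen.refl
  | @tail v v' _ hs ih =>
    obtain ⟨γ, hγ, rfl, hl⟩ := hs
    have hlong : IsLong B (P.weylGroupToPerm v a) := isLong_weylGroupToPerm _ (ha.isLong hpos)
    set δ : LongRoot b B a := ⟨P.weylGroupToPerm v a, hlong⟩ with hδ
    have hδα : α = LongRoot.reflect γ δ := LongRoot.idx_injective hα.symm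
    refine ReflTransGen.trans (ih (α := δ) rfl) ?_
    -- The length increases, so `v⁻¹ γ` is positive and pairs nonnegatively with the dominant `a`;
    -- hence `v(a)` is either fixed by `s_γ` or at an acute angle to `γ`.
    have hpos' : b.IsPos (P.weylGroupToPerm v⁻¹ γ) := by
      by_contra hc
      have := length_ofIdx_mul_lt hγ hc
      omega
    have hnn : 0 ≤ P.pairingIn ℤ δ.idx γ := by
      have h1 := ha.pairingIn_nonneg_of_isPos hpos hpos'
      rw [← pairingIn_weylGroupToPerm v, ← weylGroupToPerm_mul, mul_inv_cancel] at h1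
      change 0 ≤ P.pairingIn ℤ γ δ.idx at h1
      by_contra hc
      have := (P.pairingIn_lt_zero_iff ℤ).1 (not_le.1 hc)
      omega
    rw [hδα]
    rcases hnn.eq_or_lt with h0 | h0
    · rw [LongRoot.reflect_eq_self h0.symm]
    · exact LongRoot.path_reflect hpos hγ h0

theorem LongRoot.step_iff_weylStep (hpos : ∀ v : V, v ≠ 0 → 0 < B.form v v)
    (ha : IsHighestRoot b a) {x y : P.weylGroup} (hx : IsMinRep b (orthSimple b B a) x)
    (hy : IsMinRep b (orthSimple b B a) y) {β α : LongRoot b B a}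
    (hβ : P.weylGroupToPerm x a = β.idx) (hα : P.weylGroupToPerm y a = α.idx) (γ : ι) :
    LongRoot.Step γ β α ↔ WeylStep b γ x y := by
  have h1 := hx.length_eq_level hpos ha
  have h2 := hy.length_eq_level hpos ha
  rw [hβ] at h1
  rw [hα] at h2
  constructor
  · intro h
    refine ⟨h.1, hy.eq_of_weylGroupToPerm_eq hpos ha (hx.ofIdx_mul hpos ha h hβ) ?_, ?_⟩
    · rw [hα, weylGroupToPerm_mul, hβ, weylGroupToPerm_ofIdx, h.2.1]
    · have := h.2.2
      omega
  · rintro ⟨hγ, hxy, hl⟩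
    refine ⟨hγ, ?_, by omega⟩
    rw [← hα, hxy, weylGroupToPerm_mul, hβ, weylGroupToPerm_ofIdx]

/-- The map `x ↦ x(a)` from `X_I` to the long roots. -/
noncomputable def MinRep.toLongRoot (hpos : ∀ v : V, v ≠ 0 → 0 < B.form v v)
    (ha : IsHighestRoot b a) (x : MinRep b (orthSimple b B a)) : LongRoot b B a :=
  ⟨P.weylGroupToPerm x.toWeyl a, isLong_weylGroupToPerm _ (ha.isLong hpos)⟩

lemma MinRep.toLongRoot_bijective (hpos : ∀ v : V, v ≠ 0 → 0 < B.form v v)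
    (ha : IsHighestRoot b a) : Function.Bijective (MinRep.toLongRoot hpos ha) := by
  constructor
  · intro x y h
    exact Subtype.ext (x.2.eq_of_weylGroupToPerm_eq hpos ha y.2 (congrArg LongRoot.idx h))
  · intro α
    obtain ⟨x, hx, hxa, -⟩ := exists_isMinRep hpos ha α
    exact ⟨⟨x, hx⟩, LongRoot.idx_injective hxa⟩

/-- Paths lift step by step because every intermediate long root has a representative in X. Bruhat
chains may leave X, so the converse needs `BruhatLE.path` for arbitrary Weyl group elements. -/
lemma MinRep.le_iff_path (hpos : ∀ v : V, v ≠ 0 → 0 < B.form v v)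
    (ha : IsHighestRoot b a) (x y : MinRep b (orthSimple b B a)) :
    LongRoot.Path (MinRep.toLongRoot hpos ha x) (MinRep.toLongRoot hpos ha y) ↔ x ≤ y := by
  refine ⟨fun h => ?_, fun h => BruhatLE.path hpos ha h rfl rfl⟩
  change BruhatLE b x.toWeyl y.toWeyl
  generalize hα : MinRep.toLongRoot hpos ha y = α at h
  induction h generalizing y with
  | refl =>
    rw [(MinRep.toLongRoot_bijective hpos ha).1 hα]
    exact ReflTransGen.refl
  | @tail β α _ hs ih =>
    obtain ⟨z, hz⟩ := (MinRep.toLongRoot_bijective hpos ha).2 β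
    obtain ⟨γ, hs⟩ := hs
    refine ReflTransGen.tail (ih z hz) ⟨γ, ?_⟩
    exact (LongRoot.step_iff_weylStep hpos ha z.2 y.2 (congrArg LongRoot.idx hz)
      (congrArg LongRoot.idx hα) γ).1 hs

/-- The anti-isomorphism `x ↦ x(a)` from `X_I` to the long roots. -/
noncomputable def MinRep.orderIso (hpos : ∀ v : V, v ≠ 0 → 0 < B.form v v)
    (ha : IsHighestRoot b a) : MinRep b (orthSimple b B a) ≃o (LongRoot b B a)ᵒᵈ where
  toEquiv := (Equiv.ofBijective _ (MinRep.toLongRoot_bijective hpos ha)).trans OrderDual.toDual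
  map_rel_iff' := MinRep.le_iff_path hpos ha _ _

end Order

end LongRoots

open LongRoots in
theorem mainTheorem3 {ι V N : Type*} [Finite ι]
    [AddCommGroup V] [Module ℝ V] [AddCommGroup N] [Module ℝ N]
    (P : RootPairing ι ℝ V N) [P.IsRootSystem] [P.IsCrystallographic] [P.IsReduced]
    [P.IsIrreducible] (b : P.Base)
    -- an invariant scalar product, normalised by `min (α|α) = 1`
    (B : P.InvariantForm) (hpos : ∀ v : V, v ≠ 0 → 0 < B.form v v)
    (hmin : IsLeast (Set.range (sqLength B)) 1)
    -- the highest root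
    (a : ι) (ha : IsHighestRoot b a) :
    ∃ e : MinRep b (orthSimple b B a) ≃o (LongRoot b B a)ᵒᵈ,
      -- `e` is the map `x ↦ x(a)`
      (∀ x, (OrderDual.ofDual (e x)).idx = P.weylGroupToPerm x.toWeyl a) ∧
      -- level and length correspond
      (∀ α : LongRoot b B a,
        (length b (e.symm (OrderDual.toDual α)).toWeyl : ℤ) = level b a α.idx) ∧
      ∀ (β α : LongRoot b B a) (γ : ι), b.IsPos γ →
        (LongRoot.Step γ β α ↔
          WeylStep b γ (e.symm (OrderDual.toDual β)).toWeyl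
            (e.symm (OrderDual.toDual α)).toWeyl) ∧
        (LongRoot.Step γ β α →
          -- `β` is simple and `α` is the opposite of a simple root
          ((β.idx ∈ b.support ∧ ∃ δ ∈ b.support, P.root α.idx = - P.root δ) →
            (P.root α.idx = - P.root β.idx ∨
              P.root β.idx - P.root α.idx ∈ Set.range P.root) ∧
            (P.root α.idx = - P.root β.idx → P.pairingIn ℤ β.idx γ = 2) ∧
            (P.root β.idx - P.root α.idx ∈ Set.range P.root →
              P.pairingIn ℤ β.idx γ = 1)) ∧
          -- all other cases
          (¬ (β.idx ∈ b.support ∧ ∃ δ ∈ b.support, P.root α.idx = - P.root δ) →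
            (IsLong B γ → P.pairingIn ℤ β.idx γ = 1) ∧
            (¬ IsLong B γ → (P.pairingIn ℤ β.idx γ : ℝ) = maxSqLength B))) := by
  have hidx : ∀ α : LongRoot b B a, P.weylGroupToPerm
      ((MinRep.orderIso hpos ha).symm (OrderDual.toDual α)).toWeyl a = α.idx := fun α =>
    congrArg (fun x => (OrderDual.ofDual x).idx)
      ((MinRep.orderIso hpos ha).apply_symm_apply (OrderDual.toDual α))
  refine ⟨MinRep.orderIso hpos ha, fun _ => rfl, fun α => ?_, fun β α γ hγ =>
    ⟨LongRoot.step_iff_weylStep hpos ha (Subtype.property _) (Subtype.property _) (hidx β)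
      (hidx α) γ, fun h => ?_⟩⟩
  · exact (IsMinRep.length_eq_level hpos ha (Subtype.property _)).trans
      (congrArg (level b a) (hidx α))
  have hneg : (∃ δ ∈ b.support, P.root α.idx = -P.root δ) ↔
      P.reflectionPerm α.idx α.idx ∈ b.support := by
    constructor
    · rintro ⟨δ, hδ, e⟩
      convert! hδ
      apply P.root.injective
      rw [RootPairing.root_reflectionPerm, RootPairing.reflection_apply_self, e, neg_neg]
    · intro hα
      exact ⟨_, hα, by
        rw [RootPairing.root_reflectionPerm, RootPairing.reflection_apply_self, neg_neg]⟩
  rw [hneg]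
  refine ⟨fun ⟨hβ, hα⟩ => ⟨?_, h.pairingIn_eq_two hβ hα, h.pairingIn_eq_one hβ hα⟩,
    fun hn => ⟨fun hl => ?_, fun hl => ?_⟩⟩
  · rcases h.eq_or_mem_range hβ hα with h1 | h1
    · exact .inl h1.2
    · exact .inr ⟨γ, h1.2.symm⟩
  · have h1 := h.pairingIn_mul_sqLength hpos hn
    rw [← show sqLength B γ = maxSqLength B from hl] at h1
    exact_mod_cast (mul_eq_right₀ (sqLength_pos hpos γ).ne').1 h1
  · rw [← h.pairingIn_mul_sqLength hpos hn, sqLength_eq_one_of_not_isLong hmin hl, mul_one]
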